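/- Let $k\ge 0$ be an integer. A *bipartite partition* of $k$ (equivalently, a vector partition of $[k,k]$) is a finite multiset $b=\{[x_1,y_1],\dots,[x_a,y_a]\}$ of pairs of nonnegative integers, none equal to $[0,0]$, with $\sum_i x_i=\sum_i y_i=k$. Let $\operatorname{BiPar}_k$ be the (finite) set of these and $bp_k$ its cardinality. Let $\mathcal P_k$ be the partition algebra over $\mathbb C[x]$: it is free as a $\mathbb C[x]$-module on the set partitions of $\{1,\dots,k\}\cup\{1',\dots,k'\}$ (drawn as diagrams with top points $1,\dots,k$ and bottom points $1',\dots,k'$), and the product of two set partitions is $d\,d_1=x^{N}\,(d\circ d_1)$, where one places $d$ on top of $d_1$ and identifies the bottom points of $d$ with the top points of $d_1$, $N$ is the number of connected components that contain neither a top nor a bottom point of the concatenation, and $d\circ d_1$ is the set partition that the components induce on the top and bottom points. Let $\iota_k:\mathbb C[x]\mathfrak S_k\hookrightarrow\mathcal P_k$ be the natural inclusion, which sends $\sigma\in\mathfrak S_k$ to the set partition with blocks $\{\sigma(i),i'\}$, $1\le i\le k$. Put $e_k=\iota_k\bigl(\frac1{k!}\sum_{\sigma\in\mathfrak S_k}\sigma\bigr)$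 and let $\mathcal{SP}_k=e_k\mathcal P_k e_k$ be the spherical partition algebra. For $b\in\operatorname{BiPar}_k$ list the parts of $b$ in weakly decreasing lexicographic order, $[x_1,y_1]\ge\dots\ge[x_a,y_a]$, and let $\mathrm N(b)$ be the set partition whose $i$-th block consists of the top points $j$ with $x_1+\dots+x_{i-1}<j\le x_1+\dots+x_i$ and the bottom points $j'$ with $y_1+\dots+y_{i-1}<j\le y_1+\dots+y_i$, for $i=1,\dots,a$. **Theorem.** The map $F:\operatorname{BiPar}_k\to\mathcal{SP}_k$, $b\mapsto e_k\,\mathrm N(b)\,e_k$, is injective, and its image $\{e_k\,\mathrm N(b)\,e_k \mid b\in\operatorname{BiPar}_k\}$ is a $\mathbb C[x]$-basis of $\mathcal{SP}_k$. Hence $\operatorname{rank}_{\mathbb C[x]}\mathcal{SP}_k=bp_k$. -/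

import Mathlib

open scoped Polynomial

noncomputable section

namespace SphericalPartition

/-! ### Bipartite partitions -/

/-- Bipartite partitions of `k`, i.e. vector partitions of `[k, k]`: finite multisets of pairs of
nonnegative integers, none of them equal to `[0, 0]`, with both coordinates summing to `k`. -/
def BiPar (k : ℕ) : Type :=
  {b : Multiset (ℕ × ℕ) // (0, 0) ∉ b ∧ (b.map Prod.fst).sum = k ∧ (b.map Prod.snd).sum = k}

instance finite_biPar (k : ℕ) : Finite (BiPar k) := by
  let box : Multiset (ℕ × ℕ) :=
    (2 * k) • (Finset.range (k + 1) ×ˢ Finset.range (k + 1)).val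
  refine Set.Finite.subset (Set.finite_Iic box) ?_
  rintro b ⟨h₀, h₁, h₂⟩
  rw [Set.mem_Iic, Multiset.le_iff_count]
  intro p
  by_cases hp : p ∈ b
  · have hp₁ : p.1 ≤ k := h₁ ▸ Multiset.le_sum_of_mem (Multiset.mem_map_of_mem Prod.fst hp)
    have hp₂ : p.2 ≤ k := h₂ ▸ Multiset.le_sum_of_mem (Multiset.mem_map_of_mem Prod.snd hp)
    have hcard : b.card ≤ 2 * k := by
      have h := Multiset.card_nsmul_le_sum (s := b.map fun p => p.1 + p.2) (a := 1) (by
        intro n hn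
        obtain ⟨q, hq, rfl⟩ := Multiset.mem_map.1 hn
        rcases q with ⟨x, y⟩
        by_contra hlt
        have hx : x = 0 := by simp only at hlt; lia
        have hy : y = 0 := by simp only at hlt; lia
        subst hx hy
        exact h₀ hq)
      rw [Multiset.card_map, Multiset.sum_map_add, h₁, h₂, smul_eq_mul] at h
      lia
    have hbox : (Finset.range (k + 1) ×ˢ Finset.range (k + 1)).val.count p = 1 :=
      Multiset.count_eq_one_of_mem (Finset.nodup _)
        (by simp only [Finset.mem_val, Finset.mem_product, Finset.mem_range]; lia)
    rw [Multiset.count_nsmul, hbox, mul_one]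
    exact (Multiset.count_le_card p b).trans hcard
  · rw [Multiset.count_eq_zero_of_notMem hp]
    exact Nat.zero_le _

/-- The number of bipartite partitions of `k`. -/
def bp (k : ℕ) : ℕ := Nat.card (BiPar k)

/-- The normal form of `b`: the list of its parts in weakly decreasing lexicographic order
(`ℕ ×ₗ ℕ` is `ℕ × ℕ` with the lexicographic order). -/
def BiPar.normalForm {k : ℕ} (b : BiPar k) : List (ℕ × ℕ) :=
  ((b.1.map toLex).sort (fun p q : ℕ ×ₗ ℕ => q ≤ p)).map ofLex

/-! ### Set partitions of two rows of `k` points, and their diagrams -/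

/-- Set partitions (equivalence relations) on `{1, …, k} ∪ {1', …, k'}`; the top point `i` is
`Sum.inl i` and the bottom point `i'` is `Sum.inr i`, with `i : Fin k` counted from `0`. -/
abbrev SetPar (k : ℕ) : Type := Setoid (Fin k ⊕ Fin k)

/-- A row of points is cut, from left to right, into consecutive intervals of the given sizes;
`interval sizes p` is the index of the interval that contains the point in position `p`
(positions and indices are counted from `0`). -/
def interval : List ℕ → ℕ → ℕ
  | [], _ => 0
  | s :: sizes, p => if p < s then 0 else interval sizes (p - s) + 1

/-- The set partition whose diagram is the concatenation, from left to right, of the parts in the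
list `L`: the `i`-th block consists of the `i`-th interval of the top row, whose sizes are the
first coordinates of `L`, and of the `i`-th interval of the bottom row, whose sizes are the second
coordinates of `L`. -/
def diagram (k : ℕ) (L : List (ℕ × ℕ)) : SetPar k :=
  Setoid.ker (Sum.elim (fun i : Fin k => interval (L.map Prod.fst) i)
    (fun i : Fin k => interval (L.map Prod.snd) i))

/-! ### Concatenation of set partitions -/

/-- The three rows of points of a concatenation: top, middle and bottom. -/
abbrev Rows (k : ℕ) : Type := Fin k ⊕ Fin k ⊕ Fin k

/-- The top and the middle row. -/
def upper {k : ℕ} : Fin k ⊕ Fin k → Rows k := Sum.map id Sum.inl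

/-- The middle and the bottom row. -/
def lower {k : ℕ} : Fin k ⊕ Fin k → Rows k := Sum.inr

/-- The top and the bottom row. -/
def outer {k : ℕ} : Fin k ⊕ Fin k → Rows k := Sum.map id Sum.inr

/-- The connected components of the concatenation of `d` and `d₁`, with `d` on top of `d₁`: the
equivalence relation generated by `d` on the upper two rows and `d₁` on the lower two rows. -/
def glue {k : ℕ} (d d₁ : SetPar k) : Setoid (Rows k) :=
  d.map upper ⊔ d₁.map lower

/-- The set partition obtained from the concatenation by eliminating the internal points. -/
def compose {k : ℕ} (d d₁ : SetPar k) : SetPar k :=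
  (glue d d₁).comap outer

/-- The number of internal components of the concatenation, that is, of those that contain
no point of the top row and no point of the bottom row. -/
def internal {k : ℕ} (d d₁ : SetPar k) : ℕ :=
  {c | c ∈ (glue d d₁).classes ∧ ∀ p, outer p ∉ c}.ncard

/-- The diagram of a permutation: the top point `σ i` is joined to the bottom point `i'`. -/
def permDiagram {k : ℕ} (σ : Equiv.Perm (Fin k)) : SetPar k :=
  Setoid.ker (Sum.elim (fun i => σ.symm i) id)

/-! ### Facts on concatenation, needed for the algebra axioms -/

section Aux

variable {X Y Z : Type*}

theorem map_le_iff {f : X → Y} {r : Setoid X} {s : Setoid Y} : r.map f ≤ s ↔ r ≤ s.comap f := by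
  constructor
  · intro h x y hxy
    exact h (Setoid.le_comap_map (f := f) hxy)
  · intro h x y hxy
    induction hxy with
    | rel x y hxy =>
      obtain ⟨a, b, hab, rfl, rfl⟩ := hxy
      exact h hab
    | refl x => exact s.refl x
    | symm x y _ ih => exact s.symm ih
    | trans x y z _ _ ih₁ ih₂ => exact s.trans ih₁ ih₂

theorem map_sup (f : X → Y) (r s : Setoid X) : (r ⊔ s).map f = r.map f ⊔ s.map f := by
  apply le_antisymm
  · rw [map_le_iff]
    exact sup_le (map_le_iff.1 le_sup_left) (map_le_iff.1 le_sup_right)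
  · refine sup_le (map_le_iff.2 ?_) (map_le_iff.2 ?_)
    · exact le_sup_left.trans Setoid.le_comap_map
    · exact le_sup_right.trans Setoid.le_comap_map

theorem map_map (f : X → Y) (g : Y → Z) (r : Setoid X) : (r.map f).map g = r.map (g ∘ f) := by
  apply le_antisymm
  · rw [map_le_iff, map_le_iff]
    exact Setoid.le_comap_map (f := g ∘ f)
  · rw [map_le_iff]
    intro x y h
    exact Setoid.le_comap_map (f := g) (Setoid.le_comap_map (f := f) h)

theorem map_iff {f : X → Y} (hf : f.Injective) (r : Setoid X) (y z : Y) :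
    r.map f y z ↔ (∃ a b, r a b ∧ f a = y ∧ f b = z) ∨ y = z := by
  rw [Setoid.coe_map_of_ker_le _ _ (Setoid.ker_eq_bot_iff.2 hf ▸ bot_le)]
  rfl

theorem sup_of_trivial_off {f : Y → Z} {G H : Setoid Z}
    (hH : ∀ z w, H z w → z ∉ Set.range f → z = w) {z w : Z} (h : (G ⊔ H) z w) :
    G z w ∨ ∃ a b, G z (f a) ∧ (G.comap f ⊔ H.comap f) a b ∧ G (f b) w := by
  let C : Setoid Y := G.comap f ⊔ H.comap f
  have hGC : ∀ {a b}, G (f a) (f b) → C a b := fun h => (le_sup_left : G.comap f ≤ C) h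
  have hHC : ∀ {a b}, H (f a) (f b) → C a b := fun h => (le_sup_right : H.comap f ≤ C) h
  let K : Setoid Z :=
    { r := fun z w => G z w ∨ ∃ a b, G z (f a) ∧ C a b ∧ G (f b) w
      iseqv :=
        { refl := fun z => Or.inl (G.refl z)
          symm := by
            rintro z w (h | ⟨a, b, h₁, h₂, h₃⟩)
            · exact Or.inl (G.symm h)
            · exact Or.inr ⟨b, a, G.symm h₃, C.symm h₂, G.symm h₁⟩
          trans := by
            rintro x y z (h | ⟨a, b, h₁, h₂, h₃⟩) (h' | ⟨a', b', h₁', h₂', h₃'⟩)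
            · exact Or.inl (G.trans h h')
            · exact Or.inr ⟨a', b', G.trans h h₁', h₂', h₃'⟩
            · exact Or.inr ⟨a, b, h₁, h₂, G.trans h₃ h'⟩
            · exact Or.inr ⟨a, b', h₁,
                C.trans h₂ (C.trans (hGC (G.trans h₃ h₁')) h₂'), h₃'⟩ } }
  have hK : G ⊔ H ≤ K := by
    refine sup_le (fun x y h => Or.inl h) (fun x y h => ?_)
    by_cases hx : x ∈ Set.range f
    · by_cases hy : y ∈ Set.range f
      · obtain ⟨a, rfl⟩ := hx
        obtain ⟨b, rfl⟩ := hy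
        exact Or.inr ⟨a, b, G.refl _, hHC h, G.refl _⟩
      · rw [hH y x (H.symm h) hy]
    · rw [hH x y h hx]
  exact hK h

theorem comap_sup {f : Y → Z} {G H : Setoid Z}
    (hH : ∀ z w, H z w → z ∉ Set.range f → z = w) :
    (G ⊔ H).comap f = G.comap f ⊔ H.comap f := by
  apply le_antisymm
  · intro a b h
    have hGC : ∀ {a b}, G (f a) (f b) → (G.comap f ⊔ H.comap f) a b :=
      fun h => (le_sup_left : G.comap f ≤ G.comap f ⊔ H.comap f) h
    rcases sup_of_trivial_off hH h with h | ⟨a', b', h₁, h₂, h₃⟩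
    · exact hGC h
    · exact Setoid.trans' _ (hGC h₁) (Setoid.trans' _ h₂ (hGC h₃))
  · refine sup_le (fun a b h => ?_) (fun a b h => ?_)
    · exact (le_sup_left : G ≤ G ⊔ H) h
    · exact (le_sup_right : H ≤ G ⊔ H) h

/-- The classes of `r` that do not meet the range of `f`. -/
def avoiding (f : Y → Z) (r : Setoid Z) : Set (Set Z) := {c | c ∈ r.classes ∧ ∀ p, f p ∉ c}

theorem avoiding_sup {f : Y → Z} {G H : Setoid Z}
    (hH : ∀ z w, H z w → z ∉ Set.range f → z = w) :
    avoiding f (G ⊔ H) = avoiding f G := by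
  ext c
  constructor
  · rintro ⟨⟨y, rfl⟩, hc⟩
    have key : {x | (G ⊔ H) x y} = {x | G x y} := by
      ext x
      constructor
      · intro h
        rcases sup_of_trivial_off hH h with h | ⟨a, b, _, _, h₃⟩
        · exact h
        · exact absurd ((le_sup_left : G ≤ G ⊔ H) h₃) (hc b)
      · exact fun h => (le_sup_left : G ≤ G ⊔ H) h
    rw [key] at hc ⊢
    exact ⟨⟨y, rfl⟩, hc⟩
  · rintro ⟨⟨y, rfl⟩, hc⟩
    have key : {x | G x y} = {x | (G ⊔ H) x y} := by
      ext x
      constructor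
      · exact fun h => (le_sup_left : G ≤ G ⊔ H) h
      · intro h
        rcases sup_of_trivial_off hH h with h | ⟨a, b, _, _, h₃⟩
        · exact h
        · exact absurd h₃ (hc b)
    rw [key] at hc ⊢
    exact ⟨⟨y, rfl⟩, hc⟩

theorem avoiding_map {h : X → Z} (hh : h.Injective) {Y' : Type*} {g : Y → Z} (r : Setoid X)
    {f' : Y' → X} (hf' : ∀ x, h x ∈ Set.range g ↔ x ∈ Set.range f')
    (hoff : ∀ z, z ∉ Set.range h → z ∈ Set.range g) :
    (avoiding g (r.map h)).ncard = (avoiding f' r).ncard := by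
  have key : avoiding g (r.map h) = (Set.image h) '' avoiding f' r := by
    have hcl : ∀ x, {z | r.map h z (h x)} = h '' {x' | r x' x} := by
      intro x
      ext z
      simp only [Set.mem_ofPred_eq, Set.mem_image]
      rw [map_iff hh]
      constructor
      · rintro (⟨a, b, hab, rfl, hb⟩ | rfl)
        · exact ⟨a, hh hb ▸ hab, rfl⟩
        · exact ⟨x, r.refl x, rfl⟩
      · rintro ⟨a, ha, rfl⟩
        exact Or.inl ⟨a, x, ha, rfl, rfl⟩
    ext c
    constructor
    · rintro ⟨⟨z, rfl⟩, hc⟩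
      by_cases hz : z ∈ Set.range h
      · obtain ⟨x, rfl⟩ := hz
        refine ⟨{x' | r x' x}, ⟨⟨x, rfl⟩, fun p hp => ?_⟩, (hcl x).symm⟩
        obtain ⟨q, hq⟩ := (hf' (f' p)).2 ⟨p, rfl⟩
        apply hc q
        rw [hcl, hq]
        exact ⟨_, hp, rfl⟩
      · obtain ⟨q, rfl⟩ := hoff z hz
        exact absurd ((r.map h).refl (g q)) (hc q)
    · rintro ⟨_, ⟨⟨x, rfl⟩, hc⟩, rfl⟩
      refine ⟨⟨h x, (hcl x).symm⟩, ?_⟩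
      rintro p ⟨a, ha, hap⟩
      obtain ⟨q, rfl⟩ := (hf' a).1 ⟨p, hap.symm⟩
      exact hc q ha
  rw [key, Set.ncard_image_of_injective _ hh.image_injective]

theorem card_classes [Finite Z] (f : Y → Z) (T : Setoid Z) :
    T.classes.ncard = (T.comap f).classes.ncard + (avoiding f T).ncard := by
  have hfin : T.classes.Finite := Set.toFinite _
  have key : T.classes = {c | c ∈ T.classes ∧ ∃ p, f p ∈ c} ∪ avoiding f T := by
    ext c
    simp only [avoiding, Set.mem_union, Set.mem_ofPred_eq]
    by_cases h : ∃ p, f p ∈ c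
    · simp [h]
    · simp only [h, and_false, false_or]
      push Not at h
      simp [h]
  have hdisj : Disjoint {c | c ∈ T.classes ∧ ∃ p, f p ∈ c} (avoiding f T) := by
    rw [Set.disjoint_left]
    rintro c ⟨_, p, hp⟩ ⟨_, h⟩
    exact h p hp
  have himg : (T.comap f).classes = Set.preimage f '' {c | c ∈ T.classes ∧ ∃ p, f p ∈ c} := by
    ext c
    constructor
    · rintro ⟨y, rfl⟩
      exact ⟨{z | T z (f y)}, ⟨⟨f y, rfl⟩, y, T.refl _⟩, rfl⟩
    · rintro ⟨_, ⟨⟨z, rfl⟩, y, hy⟩, rfl⟩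
      refine ⟨y, ?_⟩
      ext x
      exact ⟨fun h => T.trans h (T.symm hy), fun h => T.trans h hy⟩
  have hinj : Set.InjOn (Set.preimage f) {c | c ∈ T.classes ∧ ∃ p, f p ∈ c} := by
    rintro _ ⟨⟨z, rfl⟩, y, hy⟩ _ ⟨⟨w, rfl⟩, _⟩ h
    have h' : T (f y) w := by
      have : y ∈ f ⁻¹' {x | T x w} := h ▸ hy
      exact this
    have hzw : T z w := T.trans (T.symm hy) h'
    ext x
    exact ⟨fun h => T.trans h hzw, fun h => T.trans h (T.symm hzw)⟩
  rw [himg, hinj.ncard_image, ← Set.ncard_union_eq hdisj (Set.toFinite _)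
    (Set.toFinite _), ← key]

theorem comap_map_square {W : Type*} {f : X → Z} {g : Y → Z} (hf : f.Injective) (hg : g.Injective)
    {p : W → X} {q : W → Y} (hpq : f ∘ p = g ∘ q)
    (hpull : ∀ a b, f a = g b → ∃ w, p w = a ∧ q w = b) (r : Setoid X) :
    (r.map f).comap g = (r.comap p).map q := by
  have hpq' : ∀ w, f (p w) = g (q w) := fun w => congrFun hpq w
  apply le_antisymm
  · intro a b h
    rcases (map_iff hf r _ _).1 h with ⟨x, y, hxy, hx, hy⟩ | h
    · obtain ⟨w, rfl, rfl⟩ := hpull _ _ hx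
      obtain ⟨w', rfl, rfl⟩ := hpull _ _ hy
      exact Setoid.le_comap_map (f := q) (r := r.comap p) hxy
    · rw [hg h]
  · rw [map_le_iff]
    intro w w' h
    change r.map f (g (q w)) (g (q w'))
    rw [← hpq', ← hpq']
    exact Setoid.le_comap_map (f := f) h

end Aux

section Assoc

variable {k : ℕ}

theorem upper_injective : (upper (k := k)).Injective :=
  Function.injective_id.sumMap Sum.inl_injective

theorem lower_injective : (lower (k := k)).Injective := Sum.inr_injective

theorem outer_injective : (outer (k := k)).Injective :=
  Function.injective_id.sumMap Sum.inr_injective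

/-- The first three of four rows. -/
def rowsABC : Rows k → Fin k ⊕ Rows k := Sum.map id (Sum.map id Sum.inl)

/-- The last three of four rows. -/
def rowsBCD : Rows k → Fin k ⊕ Rows k := Sum.inr

/-- All of four rows but the second one. -/
def rowsACD : Rows k → Fin k ⊕ Rows k := Sum.map id Sum.inr

/-- All of four rows but the third one. -/
def rowsABD : Rows k → Fin k ⊕ Rows k := Sum.map id (Sum.map id Sum.inr)

theorem rowsABC_injective : (rowsABC (k := k)).Injective :=
  Function.injective_id.sumMap (Function.injective_id.sumMap Sum.inl_injective)

theorem rowsBCD_injective : (rowsBCD (k := k)).Injective := Sum.inr_injective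

theorem rowsACD_injective : (rowsACD (k := k)).Injective :=
  Function.injective_id.sumMap Sum.inr_injective

theorem rowsABD_injective : (rowsABD (k := k)).Injective :=
  Function.injective_id.sumMap (Function.injective_id.sumMap Sum.inr_injective)

/-- The components of a concatenation of three diagrams. -/
def glue₃ (d₁ d₂ d₃ : SetPar k) : Setoid (Fin k ⊕ Rows k) :=
  d₁.map (rowsABC ∘ upper) ⊔ d₂.map (rowsABC ∘ lower) ⊔ d₃.map (rowsBCD ∘ lower)

theorem glue₃_eq_left (d₁ d₂ d₃ : SetPar k) :
    glue₃ d₁ d₂ d₃ = (glue d₁ d₂).map rowsABC ⊔ d₃.map (rowsBCD ∘ lower) := by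
  simp only [glue₃, glue, map_sup, map_map]

theorem glue₃_eq_right (d₁ d₂ d₃ : SetPar k) :
    glue₃ d₁ d₂ d₃ = (glue d₂ d₃).map rowsBCD ⊔ d₁.map (rowsABC ∘ upper) := by
  have h : (rowsABC ∘ lower : _ → Fin k ⊕ Rows k) = rowsBCD ∘ upper := by
    funext x; rcases x with x | x <;> rfl
  simp only [glue₃, glue, map_sup, map_map, h]
  rw [sup_assoc, sup_comm]

theorem trivial_off_ACD (d : SetPar k) (z w : Fin k ⊕ Rows k)
    (h : d.map (rowsBCD ∘ lower) z w) (hz : z ∉ Set.range rowsACD) : z = w := by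
  rcases (map_iff (rowsBCD_injective.comp lower_injective) _ _ _).1 h with ⟨a, b, _, rfl, _⟩ | h
  · exact absurd ⟨lower a, rfl⟩ hz
  · exact h

theorem trivial_off_ABD (d : SetPar k) (z w : Fin k ⊕ Rows k)
    (h : d.map (rowsABC ∘ upper) z w) (hz : z ∉ Set.range rowsABD) : z = w := by
  rcases (map_iff (rowsABC_injective.comp upper_injective) _ _ _).1 h with ⟨a, b, _, rfl, _⟩ | h
  · refine absurd ⟨upper a, ?_⟩ hz
    rcases a with a | a <;> rfl
  · exact h

theorem comap_ACD (d₁ d₂ d₃ : SetPar k) :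
    (glue₃ d₁ d₂ d₃).comap rowsACD = glue (compose d₁ d₂) d₃ := by
  rw [glue₃_eq_left, comap_sup (trivial_off_ACD d₃), glue, compose]
  congr 1
  · apply comap_map_square rowsABC_injective rowsACD_injective
    · funext x; rcases x with x | x <;> rfl
    · rintro (a | a | a) (b | b | b) h <;> simp [rowsABC, rowsACD, outer, upper] at h ⊢ <;>
        exact h
  · rw [show (rowsBCD ∘ lower : _ → Fin k ⊕ Rows k) = rowsACD ∘ lower from rfl, ← map_map,
      Setoid.comap_map_eq _ _ rowsACD_injective]

theorem comap_ABD (d₁ d₂ d₃ : SetPar k) :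
    (glue₃ d₁ d₂ d₃).comap rowsABD = glue d₁ (compose d₂ d₃) := by
  have h : (rowsABC ∘ upper : _ → Fin k ⊕ Rows k) = rowsABD ∘ upper := by
    funext x; rcases x with x | x <;> rfl
  rw [glue₃_eq_right, comap_sup (trivial_off_ABD d₁), glue, compose, sup_comm]
  congr 1
  · rw [h, ← map_map, Setoid.comap_map_eq _ _ rowsABD_injective]
  · apply comap_map_square rowsBCD_injective rowsABD_injective
    · funext x; rcases x with x | x <;> rfl
    · rintro (a | a | a) (b | b | b) h <;> simp [rowsBCD, rowsABD, outer, lower] at h ⊢ <;>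
        exact h.symm

theorem avoiding_ACD (d₁ d₂ d₃ : SetPar k) :
    (avoiding rowsACD (glue₃ d₁ d₂ d₃)).ncard = internal d₁ d₂ := by
  rw [glue₃_eq_left, avoiding_sup (trivial_off_ACD d₃)]
  refine avoiding_map rowsABC_injective (glue d₁ d₂) (f' := outer) ?_ ?_
  · rintro (a | a | a) <;> simp [rowsABC, rowsACD, outer]
  · rintro (a | a | a | a) <;> simp [rowsABC, rowsACD]

theorem avoiding_ABD (d₁ d₂ d₃ : SetPar k) :
    (avoiding rowsABD (glue₃ d₁ d₂ d₃)).ncard = internal d₂ d₃ := by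
  rw [glue₃_eq_right, avoiding_sup (trivial_off_ABD d₁)]
  refine avoiding_map rowsBCD_injective (glue d₂ d₃) (f' := outer) ?_ ?_
  · rintro (a | a | a) <;> simp [rowsBCD, rowsABD, outer]
  · rintro (a | a | a | a) <;> simp [rowsBCD, rowsABD]

theorem compose_assoc (d₁ d₂ d₃ : SetPar k) :
    compose (compose d₁ d₂) d₃ = compose d₁ (compose d₂ d₃) := by
  have h : (rowsACD ∘ outer : _ → Fin k ⊕ Rows k) = rowsABD ∘ outer := by
    funext x; rcases x with x | x <;> rfl
  rw [compose, ← comap_ACD, compose, ← comap_ABD]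
  change (glue₃ d₁ d₂ d₃).comap (rowsACD ∘ outer) = (glue₃ d₁ d₂ d₃).comap (rowsABD ∘ outer)
  rw [h]

theorem card_glue (d₁ d₂ : SetPar k) :
    (glue d₁ d₂).classes.ncard = (compose d₁ d₂).classes.ncard + internal d₁ d₂ :=
  card_classes outer _

theorem internal_assoc (d₁ d₂ d₃ : SetPar k) :
    internal d₁ d₂ + internal (compose d₁ d₂) d₃ =
      internal d₂ d₃ + internal d₁ (compose d₂ d₃) := by
  have h₁ := card_classes rowsACD (glue₃ d₁ d₂ d₃)
  have h₂ := card_classes rowsABD (glue₃ d₁ d₂ d₃)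
  rw [comap_ACD, avoiding_ACD, card_glue] at h₁
  rw [comap_ABD, avoiding_ABD, card_glue, ← compose_assoc] at h₂
  lia

theorem glue_perm_left (σ : Equiv.Perm (Fin k)) (d : SetPar k) :
    glue (permDiagram σ) d =
      d.comap (Sum.elim (fun i => Sum.inl (σ.symm i)) id : Rows k → Fin k ⊕ Fin k) := by
  have h₁ : permDiagram σ ≤ ((glue (permDiagram σ) d).comap upper) :=
    map_le_iff.1 le_sup_left
  have h₂ : d ≤ ((glue (permDiagram σ) d).comap lower) := map_le_iff.1 le_sup_right
  apply le_antisymm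
  · refine sup_le (map_le_iff.2 ?_) (map_le_iff.2 ?_)
    · intro a b h
      have key : ∀ c : Fin k ⊕ Fin k,
          (Sum.elim (fun i => Sum.inl (σ.symm i)) id : Rows k → Fin k ⊕ Fin k) (upper c) =
            Sum.inl (Sum.elim (fun i => σ.symm i) id c) := by
        rintro (c | c) <;> rfl
      replace h : Sum.elim (fun i => σ.symm i) id a = Sum.elim (fun i => σ.symm i) id b := h
      rw [Setoid.comap_rel, Setoid.comap_rel, key, key, h]
    · intro a b h
      exact h
  · have key : ∀ z : Rows k, glue (permDiagram σ) d z
        (lower ((Sum.elim (fun i => Sum.inl (σ.symm i)) id : Rows k → Fin k ⊕ Fin k) z)) := by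
      rintro (a | a)
      · exact h₁ (x := Sum.inl a) (y := Sum.inr (σ.symm a)) rfl
      · exact Setoid.refl' _ _
    intro z w h
    exact Setoid.trans' _ (key z) (Setoid.trans' _ (h₂ h) (Setoid.symm' _ (key w)))

theorem glue_one_right (d : SetPar k) :
    glue d (permDiagram 1) =
      d.comap (Sum.map id (Sum.elim id id) : Rows k → Fin k ⊕ Fin k) := by
  have h₁ : d ≤ ((glue d (permDiagram 1)).comap upper) := map_le_iff.1 le_sup_left
  have h₂ : permDiagram 1 ≤ ((glue d (permDiagram 1)).comap lower) := map_le_iff.1 le_sup_right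
  apply le_antisymm
  · refine sup_le (map_le_iff.2 ?_) (map_le_iff.2 ?_)
    · rintro (a | a) (b | b) h <;> exact h
    · rintro (a | a) (b | b) h <;>
      · replace h : a = b := h
        subst h
        exact d.refl _
  · have key : ∀ z : Rows k, glue d (permDiagram 1) z
        (upper ((Sum.map id (Sum.elim id id) : Rows k → Fin k ⊕ Fin k) z)) := by
      rintro (a | a | a)
      · exact Setoid.refl' _ _
      · exact Setoid.refl' _ _
      · exact h₂ (x := Sum.inr a) (y := Sum.inl a) rfl
    intro z w h
    exact Setoid.trans' _ (key z) (Setoid.trans' _ (h₁ h) (Setoid.symm' _ (key w)))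

theorem internal_eq_zero {d d₁ : SetPar k}
    (h : ∀ i, ∃ p, glue d d₁ (outer p) (Sum.inr (Sum.inl i))) : internal d d₁ = 0 := by
  rw [internal, Set.ncard_eq_zero]
  ext c
  simp only [Set.mem_empty_iff_false, iff_false]
  rintro ⟨⟨x, rfl⟩, hc⟩
  rcases x with x | x | x
  · exact hc (Sum.inl x) ((glue d d₁).refl _)
  · obtain ⟨p, hp⟩ := h x
    exact hc p hp
  · exact hc (Sum.inr x) ((glue d d₁).refl _)

theorem internal_perm_left (σ : Equiv.Perm (Fin k)) (d : SetPar k) :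
    internal (permDiagram σ) d = 0 := by
  apply internal_eq_zero
  intro i
  refine ⟨Sum.inl (σ i), ?_⟩
  rw [glue_perm_left]
  simp [outer, Setoid.comap_rel]

theorem internal_one_right (d : SetPar k) : internal d (permDiagram 1) = 0 := by
  apply internal_eq_zero
  intro i
  refine ⟨Sum.inr i, ?_⟩
  rw [glue_one_right]
  exact d.refl _

theorem compose_perm_left (σ : Equiv.Perm (Fin k)) (d : SetPar k) :
    compose (permDiagram σ) d = d.comap (Sum.map σ.symm id) := by
  rw [compose, glue_perm_left, ← Setoid.comap_comp]
  congr 1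
  funext x; rcases x with x | x <;> rfl

theorem compose_one_left (d : SetPar k) : compose (permDiagram 1) d = d := by
  rw [compose_perm_left]
  ext x y
  rcases x with x | x <;> rcases y with y | y <;> rfl

theorem compose_one_right (d : SetPar k) : compose d (permDiagram 1) = d := by
  rw [compose, glue_one_right, ← Setoid.comap_comp]
  ext x y
  rcases x with x | x <;> rcases y with y | y <;> rfl

theorem compose_perm_perm (σ τ : Equiv.Perm (Fin k)) :
    compose (permDiagram σ) (permDiagram τ) = permDiagram (σ * τ) := by
  rw [compose_perm_left]
  ext x y
  rcases x with x | x <;> rcases y with y | y <;> rfl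

end Assoc

/-! ### The partition algebra -/

/-- The partition algebra `𝒫ₖ`: as a `ℂ[x]`-module it is free on the set partitions in
`SetPar k`. -/
def PartitionAlgebra (k : ℕ) : Type := SetPar k →₀ ℂ[X]

namespace PartitionAlgebra

variable {k : ℕ}

instance : AddCommGroup (PartitionAlgebra k) := inferInstanceAs (AddCommGroup (SetPar k →₀ ℂ[X]))

instance : Module ℂ[X] (PartitionAlgebra k) := inferInstanceAs (Module ℂ[X] (SetPar k →₀ ℂ[X]))

/-- A set partition, as a basis element of the partition algebra. -/
def of (d : SetPar k) : PartitionAlgebra k := Finsupp.single d (1 : ℂ[X])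

/-- The basis of the partition algebra given by the set partitions. -/
def basis (k : ℕ) : Module.Basis (SetPar k) ℂ[X] (PartitionAlgebra k) :=
  Module.Basis.ofRepr (LinearEquiv.refl ℂ[X] (SetPar k →₀ ℂ[X]))

theorem basis_apply (d : SetPar k) : basis k d = of d := rfl

/-- The `ℂ[x]`-bilinear multiplication with `d d₁ = x ^ N • (d ∘ d₁)` on set partitions, where `N`
is the number of internal components of the concatenation. -/
def mulBilin (k : ℕ) :
    PartitionAlgebra k →ₗ[ℂ[X]] PartitionAlgebra k →ₗ[ℂ[X]] PartitionAlgebra k :=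
  (basis k).constr ℂ[X] fun d => (basis k).constr ℂ[X] fun d₁ =>
    (Polynomial.X ^ internal d d₁ : ℂ[X]) • of (compose d d₁)

theorem mulBilin_of (d d₁ : SetPar k) :
    mulBilin k (of d) (of d₁) = (Polynomial.X ^ internal d d₁ : ℂ[X]) • of (compose d d₁) := by
  rw [← basis_apply, ← basis_apply, mulBilin, Module.Basis.constr_basis,
    Module.Basis.constr_basis]

theorem mulBilin_assoc (a b c : PartitionAlgebra k) :
    mulBilin k (mulBilin k a b) c = mulBilin k a (mulBilin k b c) := by
  have h : ∀ (d₁ d₂ d₃ : SetPar k), mulBilin k (mulBilin k (of d₁) (of d₂)) (of d₃) =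
      mulBilin k (of d₁) (mulBilin k (of d₂) (of d₃)) := by
    intro d₁ d₂ d₃
    simp only [mulBilin_of, map_smul, LinearMap.smul_apply, smul_smul, ← pow_add, compose_assoc,
      internal_assoc]
  have h₁ : ∀ (d₁ d₂ : SetPar k) (c : PartitionAlgebra k),
      mulBilin k (mulBilin k (of d₁) (of d₂)) c = mulBilin k (of d₁) (mulBilin k (of d₂) c) :=
    fun d₁ d₂ c => LinearMap.congr_fun ((basis k).ext (f₁ := mulBilin k (mulBilin k (of d₁) (of d₂)))
      (f₂ := mulBilin k (of d₁) ∘ₗ mulBilin k (of d₂)) fun d₃ => h d₁ d₂ d₃) c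
  have h₂ : ∀ (d₁ : SetPar k) (b c : PartitionAlgebra k),
      mulBilin k (mulBilin k (of d₁) b) c = mulBilin k (of d₁) (mulBilin k b c) :=
    fun d₁ b c => LinearMap.congr_fun ((basis k).ext
      (f₁ := (mulBilin k).flip c ∘ₗ mulBilin k (of d₁))
      (f₂ := mulBilin k (of d₁) ∘ₗ (mulBilin k).flip c) fun d₂ => h₁ d₁ d₂ c) b
  exact LinearMap.congr_fun ((basis k).ext
      (f₁ := (mulBilin k).flip c ∘ₗ (mulBilin k).flip b)
      (f₂ := (mulBilin k).flip (mulBilin k b c)) fun d₁ => h₂ d₁ b c) a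

theorem one_mulBilin (a : PartitionAlgebra k) : mulBilin k (of (permDiagram 1)) a = a := by
  have h : mulBilin k (of (permDiagram 1)) = LinearMap.id := by
    refine (basis k).ext fun d => ?_
    rw [basis_apply, mulBilin_of, internal_perm_left, compose_one_left, pow_zero, one_smul]
    rfl
  rw [h]
  rfl

theorem mulBilin_one (a : PartitionAlgebra k) : mulBilin k a (of (permDiagram 1)) = a := by
  have h : (mulBilin k).flip (of (permDiagram 1)) = LinearMap.id := by
    refine (basis k).ext fun d => ?_
    rw [LinearMap.flip_apply, basis_apply, mulBilin_of, internal_one_right, compose_one_right,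
      pow_zero, one_smul]
    rfl
  exact LinearMap.congr_fun h a

instance : Ring (PartitionAlgebra k) :=
  { (inferInstance : AddCommGroup (PartitionAlgebra k)) with
    mul := fun a b => mulBilin k a b
    one := of (permDiagram 1)
    left_distrib := fun a b c => map_add (mulBilin k a) b c
    right_distrib := fun a b c => LinearMap.map_add₂ (mulBilin k) a b c
    zero_mul := fun a => LinearMap.map_zero₂ (mulBilin k) a
    mul_zero := fun a => map_zero (mulBilin k a)
    mul_assoc := mulBilin_assoc
    one_mul := one_mulBilin
    mul_one := mulBilin_one }

instance : Algebra ℂ[X] (PartitionAlgebra k) :=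
  Algebra.ofModule (fun r a b => LinearMap.map_smul₂ (mulBilin k) r a b)
    (fun r a b => map_smul (mulBilin k a) r b)

theorem of_mul_of (d d₁ : SetPar k) :
    of d * of d₁ = (Polynomial.X ^ internal d d₁ : ℂ[X]) • of (compose d d₁) :=
  mulBilin_of d d₁

/-- Permutations, as elements of the partition algebra. -/
def ofPerm (k : ℕ) : Equiv.Perm (Fin k) →* PartitionAlgebra k where
  toFun σ := of (permDiagram σ)
  map_one' := rfl
  map_mul' σ τ := by
    rw [of_mul_of, internal_perm_left, compose_perm_perm, pow_zero, one_smul]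

/-- The natural algebra homomorphism from the group algebra of the symmetric group to the
partition algebra. -/
def ι (k : ℕ) : MonoidAlgebra ℂ[X] (Equiv.Perm (Fin k)) →ₐ[ℂ[X]] PartitionAlgebra k :=
  MonoidAlgebra.lift ℂ[X] (PartitionAlgebra k) (Equiv.Perm (Fin k)) (ofPerm k)

/-- The symmetrizing idempotent `eₖ`, the image under `ι k` of `1 / k!` times the sum of all
permutations. -/
def e (k : ℕ) : PartitionAlgebra k :=
  ι k (Polynomial.C ((k.factorial : ℂ)⁻¹) •
    ∑ σ : Equiv.Perm (Fin k), MonoidAlgebra.of ℂ[X] (Equiv.Perm (Fin k)) σ)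

end PartitionAlgebra

/-! ### The spherical partition algebra -/

open PartitionAlgebra

/-- The spherical partition algebra `eₖ 𝒫ₖ eₖ`, as a `ℂ[x]`-submodule of `𝒫ₖ`. -/
def SphericalAlgebra (k : ℕ) : Submodule ℂ[X] (PartitionAlgebra k) :=
  LinearMap.range (LinearMap.mulLeftRight ℂ[X] (e k, e k))

theorem mem_sphericalAlgebra {k : ℕ} (a : PartitionAlgebra k) :
    a ∈ SphericalAlgebra k ↔ ∃ p, e k * p * e k = a := by
  simp only [SphericalAlgebra, LinearMap.mem_range, LinearMap.mulLeftRight_apply]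

/-- The map `b ↦ eₖ N(b) eₖ` from bipartite partitions of `k` to the spherical partition
algebra. -/
def F (k : ℕ) (b : BiPar k) : SphericalAlgebra k :=
  ⟨e k * of (diagram k b.normalForm) * e k, (mem_sphericalAlgebra _).2 ⟨_, rfl⟩⟩

end SphericalPartition

end

/-!
The group `𝔖ₖ × 𝔖ₖ` acts on set partitions by relabelling the top and the bottom points, and
multiplication by `eₖ` on both sides averages over this action. The *type* of a set partition
(`typeOf`), the multiset of the pairs (number of top points, number of bottom points) over its
blocks, is a bipartite partition of `k`. It is constant on the orbits (`typeOf_comap`), it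
separates them (`exists_comap_of_typeOf_eq`), and `N(b)` has type `b`
(`typeOf_diagram_normalForm`). Hence the orbits correspond to the bipartite partitions, with
representatives `N(b)`.

Since `eₖ` absorbs permutations, `eₖ d eₖ` depends only on the orbit of `d`, so the elements
`eₖ N(b) eₖ` span. They are linearly independent because the `ℂ[x]`-linear map from `𝒫ₖ` to the
free module on `BiParₖ` that sends each set partition to its type (`typeMap`) sends
`eₖ d eₖ` to the type of `d`, thus `eₖ N(b) eₖ` to the basis vector `b`.
-/

open scoped Polynomial

noncomputable section

namespace SphericalPartition

open PartitionAlgebra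

/-! ### Fibres of maps between finite types -/

section Fibers

variable {α β γ ι κ : Type*}

theorem exists_equiv_of_card_fiber_eq [Finite α] [Finite β] {f : α → γ} {g : β → γ}
    (h : ∀ c, Nat.card {a // f a = c} = Nat.card {b // g b = c}) :
    ∃ φ : α ≃ β, ∀ a, g (φ a) = f a := by
  let φ := fun c => Classical.choice (Finite.card_eq.1 (h c))
  exact ⟨(Equiv.sigmaFiberEquiv f).symm.trans
    ((Equiv.sigmaCongrRight φ).trans (Equiv.sigmaFiberEquiv g)), fun a => (φ (f a) ⟨a, rfl⟩).2⟩

theorem count_map_univ [Fintype α] [DecidableEq γ] (f : α → γ) (c : γ) :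
    ((Finset.univ : Finset α).val.map f).count c = Nat.card {a // f a = c} := by
  rw [Multiset.count_map, Nat.card_eq_fintype_card, Fintype.card_subtype, Finset.card_def,
    Finset.filter_val]
  simp only [eq_comm]

theorem exists_equiv_of_map_univ_eq [Fintype α] [Fintype β] {f : α → γ} {g : β → γ}
    (h : (Finset.univ : Finset α).val.map f = (Finset.univ : Finset β).val.map g) :
    ∃ φ : α ≃ β, ∀ a, g (φ a) = f a := by
  classical
  exact exists_equiv_of_card_fiber_eq fun c => by
    rw [← count_map_univ, ← count_map_univ, h]

theorem sum_card_fiber [Fintype ι] [Finite α] (f : α → ι) :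
    ∑ c, Nat.card {a // f a = c} = Nat.card α := by
  rw [← Nat.card_sigma, Nat.card_congr (Equiv.sigmaFiberEquiv f)]

theorem card_fiber_comp_equiv (f : α → γ) (σ : β ≃ α) (c : γ) :
    Nat.card {b // f (σ b) = c} = Nat.card {a // f a = c} :=
  Nat.card_congr (σ.subtypeEquiv fun _ => Iff.rfl)

theorem card_fiber_equiv_comp (f : α → β) (φ : β ≃ γ) (c : γ) :
    Nat.card {a // φ (f a) = c} = Nat.card {a // f a = φ.symm c} :=
  Nat.card_congr (Equiv.subtypeEquivRight fun _ => φ.eq_symm_apply.symm)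

/-- The multiset of the pairs of cardinalities of the fibres of `f` and `g` over the points of
their common codomain. Points outside both ranges contribute `(0, 0)`. -/
def fiberSizes [Fintype ι] (f : α → ι) (g : β → ι) : Multiset (ℕ × ℕ) :=
  (Finset.univ : Finset ι).val.map fun c => (Nat.card {a // f a = c}, Nat.card {b // g b = c})

theorem fiberSizes_equiv_comp [Fintype ι] [Fintype κ] (φ : ι ≃ κ) (f : α → ι) (g : β → ι) :
    fiberSizes (φ ∘ f) (φ ∘ g) = fiberSizes f g := by
  rw [fiberSizes, fiberSizes, ← Finset.map_univ_equiv φ, Finset.map_val, Multiset.map_map]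
  simp

theorem fiberSizes_comp_equiv [Fintype ι] (f : α → ι) (g : β → ι) (σ : α ≃ α) (τ : β ≃ β) :
    fiberSizes (f ∘ σ) (g ∘ τ) = fiberSizes f g := by
  simp only [fiberSizes, Function.comp_apply, card_fiber_comp_equiv]

theorem exists_equivs_of_fiberSizes_eq [Finite α] [Finite β] [Fintype ι] [Fintype κ]
    {f : α → ι} {g : β → ι} {f' : α → κ} {g' : β → κ} (h : fiberSizes f g = fiberSizes f' g') :
    ∃ (φ : ι ≃ κ) (σ : α ≃ α) (τ : β ≃ β),
      (∀ a, f' (σ a) = φ (f a)) ∧ ∀ b, g' (τ b) = φ (g b) := by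
  obtain ⟨φ, hφ⟩ := exists_equiv_of_map_univ_eq h
  simp only [Prod.mk.injEq] at hφ
  obtain ⟨σ, hσ⟩ := exists_equiv_of_card_fiber_eq (f := φ ∘ f) (g := f') fun c => by
    rw [← φ.apply_symm_apply c, (hφ _).1, φ.apply_symm_apply]
    exact card_fiber_equiv_comp f φ c
  obtain ⟨τ, hτ⟩ := exists_equiv_of_card_fiber_eq (f := φ ∘ g) (g := g') fun c => by
    rw [← φ.apply_symm_apply c, (hφ _).2, φ.apply_symm_apply]
    exact card_fiber_equiv_comp g φ c
  exact ⟨φ, σ, τ, hσ, hτ⟩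

end Fibers

/-! ### The type of a set partition -/

variable {k : ℕ}

instance fintypeQuotient (d : SetPar k) : Fintype (Quotient d) := Fintype.ofFinite _

/-- The block of a top point. -/
def topBlock (d : SetPar k) (i : Fin k) : Quotient d := Quotient.mk d (Sum.inl i)

/-- The block of a bottom point. -/
def bottomBlock (d : SetPar k) (i : Fin k) : Quotient d := Quotient.mk d (Sum.inr i)

/-- The type of a set partition: the bipartite partition whose parts are the pairs
(number of top points, number of bottom points) of its blocks. -/
def typeOf (d : SetPar k) : BiPar k := by
  refine ⟨fiberSizes (topBlock d) (bottomBlock d), fun h => ?_, ?_, ?_⟩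
  · obtain ⟨q, -, hq⟩ := Multiset.mem_map.1 h
    rw [Prod.mk.injEq, Finite.card_eq_zero_iff, Finite.card_eq_zero_iff] at hq
    obtain ⟨x | x, rfl⟩ := Quotient.exists_rep q
    · exact hq.1.elim ⟨x, rfl⟩
    · exact hq.2.elim ⟨x, rfl⟩
  · rw [fiberSizes, Multiset.map_map]
    exact (sum_card_fiber (topBlock d)).trans (Nat.card_fin k)
  · rw [fiberSizes, Multiset.map_map]
    exact (sum_card_fiber (bottomBlock d)).trans (Nat.card_fin k)

theorem typeOf_ker {ι : Type*} [Fintype ι] {f g : Fin k → ι}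
    (h : Function.Surjective (Sum.elim f g)) :
    (typeOf (Setoid.ker (Sum.elim f g))).1 = fiberSizes f g :=
  (fiberSizes_equiv_comp (Setoid.quotientKerEquivOfSurjective _ h) _ _).symm

/-- The type is invariant under relabelling the top and the bottom points. -/
theorem typeOf_comap (d : SetPar k) (σ τ : Equiv.Perm (Fin k)) :
    typeOf (d.comap (Sum.map σ τ)) = typeOf d := by
  have h : d.comap (Sum.map σ τ) = Setoid.ker (Sum.elim (topBlock d ∘ σ) (bottomBlock d ∘ τ)) := by
    ext x y
    rw [Setoid.comap_rel, Setoid.ker_def]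
    rcases x with x | x <;> rcases y with y | y <;> exact Quotient.eq.symm
  rw [h]
  apply Subtype.ext
  rw [typeOf_ker, fiberSizes_comp_equiv]
  · rfl
  · intro q
    obtain ⟨x | x, rfl⟩ := Quotient.exists_rep q
    · exact ⟨Sum.inl (σ.symm x), congrArg (topBlock d) (σ.apply_symm_apply x)⟩
    · exact ⟨Sum.inr (τ.symm x), congrArg (bottomBlock d) (τ.apply_symm_apply x)⟩

/-- Set partitions of the same type differ by a relabelling of the top and the bottom points. -/
theorem exists_comap_of_typeOf_eq {d d' : SetPar k} (h : typeOf d = typeOf d') :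
    ∃ σ τ : Equiv.Perm (Fin k), d = d'.comap (Sum.map σ τ) := by
  obtain ⟨φ, σ, τ, hσ, hτ⟩ := exists_equivs_of_fiberSizes_eq (congrArg Subtype.val h)
  refine ⟨σ, τ, ?_⟩
  have key : ∀ x, Quotient.mk d' (Sum.map σ τ x) = φ (Quotient.mk d x) := by
    rintro (x | x)
    · exact hσ x
    · exact hτ x
  ext x y
  exact Quotient.eq.symm.trans
    (φ.apply_eq_iff_eq.symm.trans (by rw [← key, ← key]; exact Quotient.eq))

/-! ### The type of a normal form -/

theorem interval_lt_length {s : List ℕ} {p : ℕ} (h : p < s.sum) : interval s p < s.length := by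
  induction s generalizing p with
  | nil => simp at h
  | cons a s ih =>
    rw [List.sum_cons] at h
    rw [interval, List.length_cons]
    split_ifs with hp
    · lia
    · have := ih (p := p - a) (by lia)
      lia

theorem card_filter_interval (s : List ℕ) {j : ℕ} (hj : j < s.length) :
    ((Finset.range s.sum).filter fun p => interval s p = j).card = s[j] := by
  induction s generalizing j with
  | nil => simp at hj
  | cons a s ih =>
    have h₁ : ∀ p ∈ Finset.range a, (if interval (a :: s) p = j then 1 else 0) =
        if 0 = j then 1 else 0 := fun p hp => by
      rw [interval, if_pos (Finset.mem_range.1 hp)]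
    have h₂ : ∀ p ∈ Finset.range s.sum, (if interval (a :: s) (a + p) = j then 1 else 0) =
        if interval s p + 1 = j then 1 else 0 := fun p _ => by
      rw [interval, if_neg (Nat.not_lt.2 (Nat.le_add_right a p)), Nat.add_sub_cancel_left]
    rw [Finset.card_filter, List.sum_cons, Finset.sum_range_add, Finset.sum_congr rfl h₁,
      Finset.sum_congr rfl h₂]
    cases j with
    | zero => simp
    | succ j =>
      have := ih (j := j) (by simpa using hj)
      rw [Finset.card_filter] at this
      simpa using this

/-- The index of the interval that contains `i`, for sizes that add up to `k`. -/
def intervalFin (s : List ℕ) (hs : s.sum = k) (i : Fin k) : Fin s.length :=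
  ⟨interval s i, interval_lt_length (hs ▸ i.2)⟩

theorem card_fiber_intervalFin (s : List ℕ) (hs : s.sum = k) (j : Fin s.length) :
    Nat.card {i : Fin k // intervalFin s hs i = j} = s[j] := by
  subst hs
  rw [Nat.card_eq_fintype_card, Fintype.card_subtype, Finset.card_filter, Fin.getElem_fin,
    ← card_filter_interval s j.2, Finset.card_filter, ← Fin.sum_univ_eq_sum_range]
  simp only [intervalFin, Fin.ext_iff]

theorem typeOf_diagram {L : List (ℕ × ℕ)} (h₀ : (0, 0) ∉ L) (h₁ : (L.map Prod.fst).sum = k)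
    (h₂ : (L.map Prod.snd).sum = k) : (typeOf (diagram k L)).1 = L := by
  let f : Fin k → Fin L.length := fun i => (intervalFin _ h₁ i).cast (List.length_map _)
  let g : Fin k → Fin L.length := fun i => (intervalFin _ h₂ i).cast (List.length_map _)
  have hf : ∀ j, Nat.card {i // f i = j} = L[j].1 := fun j => by
    have := card_fiber_intervalFin _ h₁ (j.cast (List.length_map _).symm)
    simpa [f, Fin.ext_iff] using this
  have hg : ∀ j, Nat.card {i // g i = j} = L[j].2 := fun j => by
    have := card_fiber_intervalFin _ h₂ (j.cast (List.length_map _).symm)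
    simpa [g, Fin.ext_iff] using this
  have hd : diagram k L = Setoid.ker (Sum.elim f g) := by
    ext x y
    rw [diagram, Setoid.ker_def, Setoid.ker_def]
    rcases x with x | x <;> rcases y with y | y <;> simp [f, g, intervalFin]
  -- An index `j` outside both ranges would give the excluded part `(0, 0)`.
  have hsurj : Function.Surjective (Sum.elim f g) := by
    intro j
    by_contra! hj
    have hf₀ : L[j].1 = 0 := by
      rw [← hf, Finite.card_eq_zero_iff]
      exact ⟨fun i => hj (Sum.inl i.1) i.2⟩
    have hg₀ : L[j].2 = 0 := by
      rw [← hg, Finite.card_eq_zero_iff]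
      exact ⟨fun i => hj (Sum.inr i.1) i.2⟩
    have : L[j] = (0, 0) := Prod.ext hf₀ hg₀
    exact h₀ (this ▸ List.getElem_mem j.2)
  rw [hd, typeOf_ker hsurj, fiberSizes]
  simp only [hf, hg]
  rw [Fin.univ_val_map]
  simp

theorem coe_normalForm (b : BiPar k) : (b.normalForm : Multiset (ℕ × ℕ)) = b.1 := by
  rw [BiPar.normalForm, ← Multiset.map_coe, Multiset.sort_eq, Multiset.map_map]
  exact Multiset.map_id _

/-- The set partition `N(b)` has type `b`. -/
theorem typeOf_diagram_normalForm (b : BiPar k) : typeOf (diagram k b.normalForm) = b := by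
  apply Subtype.ext
  rw [typeOf_diagram, coe_normalForm]
  · rw [← Multiset.mem_coe, coe_normalForm]
    exact b.2.1
  · rw [← Multiset.sum_coe, ← Multiset.map_coe, coe_normalForm]
    exact b.2.2.1
  · rw [← Multiset.sum_coe, ← Multiset.map_coe, coe_normalForm]
    exact b.2.2.2

/-! ### Products with permutations -/

theorem glue_perm_right (d : SetPar k) (τ : Equiv.Perm (Fin k)) :
    glue d (permDiagram τ) =
      d.comap (Sum.map id (Sum.elim id τ) : Rows k → Fin k ⊕ Fin k) := by
  have h₁ : d ≤ (glue d (permDiagram τ)).comap upper := map_le_iff.1 le_sup_left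
  have h₂ : permDiagram τ ≤ (glue d (permDiagram τ)).comap lower := map_le_iff.1 le_sup_right
  apply le_antisymm
  · refine sup_le (map_le_iff.2 ?_) (map_le_iff.2 ?_)
    · rintro (a | a) (b | b) h <;> exact h
    · intro a b h
      have key : ∀ c : Fin k ⊕ Fin k,
          (Sum.map id (Sum.elim id τ) : Rows k → Fin k ⊕ Fin k) (lower c) =
            Sum.inr (τ (Sum.elim (fun i => τ.symm i) id c)) := by
        rintro (c | c)
        · exact congrArg Sum.inr (τ.apply_symm_apply c).symm
        · rfl
      replace h : Sum.elim (fun i => τ.symm i) id a = Sum.elim (fun i => τ.symm i) id b := h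
      rw [Setoid.comap_rel, Setoid.comap_rel, key, key, h]
  · have key : ∀ z : Rows k, glue d (permDiagram τ) z
        (upper ((Sum.map id (Sum.elim id τ) : Rows k → Fin k ⊕ Fin k) z)) := by
      rintro (a | a | a)
      · exact Setoid.refl' _ _
      · exact Setoid.refl' _ _
      · exact h₂ (x := Sum.inr a) (y := Sum.inl (τ a)) (τ.symm_apply_apply a).symm
    intro z w h
    exact Setoid.trans' _ (key z) (Setoid.trans' _ (h₁ h) (Setoid.symm' _ (key w)))

theorem internal_perm_right (d : SetPar k) (τ : Equiv.Perm (Fin k)) :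
    internal d (permDiagram τ) = 0 := by
  apply internal_eq_zero
  intro i
  refine ⟨Sum.inr (τ.symm i), ?_⟩
  rw [glue_perm_right]
  simp [outer, Setoid.comap_rel]

theorem compose_perm_right (d : SetPar k) (τ : Equiv.Perm (Fin k)) :
    compose d (permDiagram τ) = d.comap (Sum.map id τ) := by
  rw [compose, glue_perm_right, ← Setoid.comap_comp]
  congr 1
  funext x; rcases x with x | x <;> rfl

theorem ofPerm_mul_of_mul_ofPerm (σ τ : Equiv.Perm (Fin k)) (d : SetPar k) :
    ofPerm k σ * of d * ofPerm k τ = of (d.comap (Sum.map σ.symm τ)) := by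
  change of (permDiagram σ) * of d * of (permDiagram τ) = _
  rw [of_mul_of, internal_perm_left, pow_zero, one_smul, of_mul_of, internal_perm_right, pow_zero,
    one_smul, compose_perm_left, compose_perm_right, ← Setoid.comap_comp]
  congr 2
  funext x; rcases x with x | x <;> rfl

/-! ### The symmetrizing idempotent -/

theorem e_eq (k : ℕ) :
    e k = Polynomial.C ((k.factorial : ℂ)⁻¹) • ∑ σ : Equiv.Perm (Fin k), ofPerm k σ := by
  simp [e, ι, map_sum]

theorem e_mul_ofPerm (σ : Equiv.Perm (Fin k)) : e k * ofPerm k σ = e k := by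
  rw [e_eq, smul_mul_assoc, Finset.sum_mul]
  simp only [← map_mul]
  exact congrArg _ (Equiv.sum_comp (Equiv.mulRight σ) fun ρ => ofPerm k ρ)

theorem ofPerm_mul_e (σ : Equiv.Perm (Fin k)) : ofPerm k σ * e k = e k := by
  rw [e_eq, mul_smul_comm, Finset.mul_sum]
  simp only [← map_mul]
  exact congrArg _ (Equiv.sum_comp (Equiv.mulLeft σ) fun ρ => ofPerm k ρ)

/-- The symmetrization of a set partition depends only on its type. -/
theorem e_mul_of_mul_e_eq_of_typeOf_eq {d d' : SetPar k} (h : typeOf d = typeOf d') :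
    e k * of d * e k = e k * of d' * e k := by
  obtain ⟨σ, τ, rfl⟩ := exists_comap_of_typeOf_eq h
  have := ofPerm_mul_of_mul_ofPerm σ.symm τ d'
  rw [Equiv.symm_symm] at this
  rw [← this, mul_assoc, mul_assoc, ofPerm_mul_e, mul_assoc, ← mul_assoc (e k), e_mul_ofPerm,
    mul_assoc]

theorem e_mul_of_mul_e (d : SetPar k) :
    e k * of d * e k = (Polynomial.C ((k.factorial : ℂ)⁻¹) * Polynomial.C ((k.factorial : ℂ)⁻¹)) •
      ∑ σ : Equiv.Perm (Fin k), ∑ τ : Equiv.Perm (Fin k), of (d.comap (Sum.map σ.symm τ)) := by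
  rw [e_eq, smul_mul_assoc, smul_mul_assoc, mul_smul_comm, smul_smul, Finset.sum_mul,
    Finset.sum_mul]
  simp only [Finset.mul_sum, ofPerm_mul_of_mul_ofPerm]

/-! ### The basis of the spherical partition algebra -/

/-- The `ℂ[x]`-linear map that sends each set partition to its type. -/
def typeMap (k : ℕ) : PartitionAlgebra k →ₗ[ℂ[X]] (BiPar k →₀ ℂ[X]) :=
  (basis k).constr ℂ[X] fun d => Finsupp.single (typeOf d) 1

theorem typeMap_of (d : SetPar k) : typeMap k (of d) = Finsupp.single (typeOf d) 1 := by
  rw [← basis_apply, typeMap, Module.Basis.constr_basis]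

theorem typeMap_e_mul_of_mul_e (d : SetPar k) :
    typeMap k (e k * of d * e k) = Finsupp.single (typeOf d) 1 := by
  have hk : (k.factorial : ℂ) ≠ 0 := Nat.cast_ne_zero.2 k.factorial_ne_zero
  rw [e_mul_of_mul_e, map_smul]
  simp only [map_sum, typeMap_of, typeOf_comap, Finset.sum_const, Finset.card_univ,
    Fintype.card_perm, Fintype.card_fin]
  rw [smul_smul, ← Nat.cast_smul_eq_nsmul ℂ[X], smul_smul, Nat.cast_mul, ← Polynomial.C_eq_natCast,
    ← Polynomial.C_mul, ← Polynomial.C_mul, ← Polynomial.C_mul]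
  have : (k.factorial : ℂ)⁻¹ * (k.factorial : ℂ)⁻¹ * (k.factorial * k.factorial) = 1 := by
    field_simp
  rw [this, Polynomial.C_1, one_smul]

theorem linearIndependent_F (k : ℕ) : LinearIndependent ℂ[X] (F k) := by
  apply LinearIndependent.of_comp (typeMap k ∘ₗ (SphericalAlgebra k).subtype)
  have : (typeMap k ∘ₗ (SphericalAlgebra k).subtype) ∘ F k =
      fun b => Finsupp.single b (1 : ℂ[X]) := by
    funext b
    exact (typeMap_e_mul_of_mul_e _).trans (by rw [typeOf_diagram_normalForm])
  rw [this]
  exact Finsupp.linearIndependent_single_one _ _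

theorem F_typeOf (d : SetPar k) : (F k (typeOf d) : PartitionAlgebra k) = e k * of d * e k :=
  e_mul_of_mul_e_eq_of_typeOf_eq (typeOf_diagram_normalForm _)

theorem span_range_F (k : ℕ) : Submodule.span ℂ[X] (Set.range (F k)) = ⊤ := by
  refine Submodule.map_injective_of_injective (SphericalAlgebra k).subtype_injective ?_
  rw [Submodule.map_span, Submodule.map_subtype_top]
  apply le_antisymm
  · rw [Submodule.span_le]
    rintro _ ⟨a, -, rfl⟩
    exact a.2
  · change LinearMap.range (LinearMap.mulLeftRight ℂ[X] (e k, e k)) ≤ _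
    rw [LinearMap.range_eq_map, ← (basis k).span_eq, Submodule.map_span]
    apply Submodule.span_mono
    rintro _ ⟨_, ⟨d, rfl⟩, rfl⟩
    exact ⟨F k (typeOf d), ⟨_, rfl⟩, F_typeOf d⟩

end SphericalPartition

end

theorem theorem5p1 (k : ℕ) :
    Function.Injective (SphericalPartition.F k) ∧
    (LinearIndependent ℂ[X] (Subtype.val :
        Set.range (SphericalPartition.F k) → SphericalPartition.SphericalAlgebra k) ∧
      Submodule.span ℂ[X] (Set.range (SphericalPartition.F k)) = ⊤) ∧
    Module.rank ℂ[X] (SphericalPartition.SphericalAlgebra k) = SphericalPartition.bp k := by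
  have hli := SphericalPartition.linearIndependent_F k
  have hspan := SphericalPartition.span_range_F k
  refine ⟨hli.injective, ⟨hli.linearIndepOn_id, hspan⟩, ?_⟩
  rw [← (Module.Basis.mk hli hspan.ge).mk_eq_rank'', SphericalPartition.bp, Nat.cast_card]
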